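/- For an integrable function $g:\mathbb R\to\mathbb C$ let $\hat g(s)=\int_{-\infty}^{\infty}e^{-ist}g(t)\,dt$ $(s\in\mathbb R)$. Absolutely continuous means absolutely continuous on every compact interval, so that the derivative exists almost everywhere; $\mathcal{BV}(\mathbb R)$ is the set of functions of bounded variation on $\mathbb R$, and a derivative (defined only almost everywhere) is said to be in $\mathcal{BV}(\mathbb R)$ if it agrees almost everywhere with a function of bounded variation on $\mathbb R$. (a) Let $g\in L^1(\mathbb R)$ be absolutely continuous such that $\lim_{|x|\to\infty}g(x)=0$ and $g'\in L^p(\mathbb R)$ for some $1<p\le 2$. Then $\hat g\in L^1(\mathbb R)$. (b) Let $g\in L^1(\mathbb R)$ and define $h(x)=xg(x)$. Suppose that $h\in L^1(\mathbb R)$, $h$ is absolutely continuous, $\lim_{|x|\to\infty}h(x)=0$ and $h'\in L^p(\mathbb R)$ for some $1<p\le 2$. Then $\hat g\in\mathcal{BV}(\mathbb R)$. (c) Let $g$ be absolutely continuous such that $g,g'\in L^1(\mathbb R)$ and $g'\in\mathcal{BV}(\mathbb R)$. Then $\hat g\in L^1(\mathbb R)$. (d) Let $g\in L^1(\mathbb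 R)$ and define $h(x)=xg(x)$. Suppose that $h\in L^1(\mathbb R)$, $h$ is absolutely continuous, $h'\in L^1(\mathbb R)$ and $h'\in\mathcal{BV}(\mathbb R)$. Then $\hat g\in\mathcal{BV}(\mathbb R)$. -/

import Mathlib

open Filter Topology MeasureTheory
open scoped ENNReal

/-- The Fourier transform `ĝ(s) = ∫ e^{-ist} g(t) dt` of an integrable function on the line. -/
noncomputable def fourierHat (g : ℝ → ℂ) (s : ℝ) : ℂ :=
  ∫ t : ℝ, Complex.exp (-(Complex.I * (s : ℂ) * (t : ℂ))) * g t

/-- `f` is absolutely continuous on the line: it is so on every compact interval. (When `f'` lies in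
some `L^p(ℝ)` with `1 ≤ p`, this is the same as the `ε`-`δ` condition on the whole line.) -/
def AbsContOnLine (f : ℝ → ℂ) : Prop :=
  ∀ a b : ℝ, AbsolutelyContinuousOnInterval f a b

/-- The a.e. defined derivative of `f` belongs to `BV(ℝ)`: it agrees almost everywhere with a
function whose total variation on the line is finite. -/
def DerivIsBV (f : ℝ → ℂ) : Prop :=
  ∃ v : ℝ → ℂ, BoundedVariationOn v Set.univ ∧ deriv f =ᵐ[volume] v

/-! Everything rests on (a), a Bernstein-type argument. Hölder and Fubini bound `‖g(· + h) - g‖₂²`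
by `h ^ (3 - 2/p) * ‖g'‖_p²`. By Plancherel this controls `(e^{2πihξ} - 1) 𝓕 g` in `L²`, and the
multiplier has modulus at least 1 when `|ξ|` is comparable to `1/h`. So the `L²` mass of `𝓕 g` on
the `k`-th dyadic block is `O(2 ^ (-k(3 - 2/p)))`. As `p > 1` makes the exponent exceed 1,
Cauchy-Schwarz on the blocks gives a convergent geometric series. For (b), the derivative of the
transform of `g` is a multiple of that of `h`, which is integrable by (a). In (c) and (d) the
derivative is integrable and essentially bounded, hence in `L²`: these are the case `p = 2`. -/

/-- **Fundamental theorem of calculus** for complex-valued absolutely continuous functions. -/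
theorem AbsContOnLine.integral_deriv_eq_sub {f : ℝ → ℂ} (hf : AbsContOnLine f)
    (hd : LocallyIntegrable (deriv f) volume) (a b : ℝ) :
    ∫ x in a..b, deriv f x = f b - f a := by
  have hi : IntervalIntegrable (deriv f) volume a b :=
    intervalIntegrable_iff.2 ((hd.integrableOn_isCompact isCompact_uIcc).mono_set
      Set.uIoc_subset_uIcc)
  -- Reduction to the real-valued theorem: `L` will be the real and the imaginary part.
  have key (L : ℂ →L[ℝ] ℝ) (hL : ∀ z, ‖L z‖ ≤ ‖z‖) :
      L (∫ x in a..b, deriv f x) = L (f b - f a) := by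
    have hac : AbsolutelyContinuousOnInterval (fun x => L (f x)) a b := by
      refine squeeze_zero (fun E => Finset.sum_nonneg fun _ _ => dist_nonneg) (fun E => ?_) (hf a b)
      refine Finset.sum_le_sum fun i _ => ?_
      rw [dist_eq_norm, dist_eq_norm, ← map_sub]
      exact hL _
    rw [map_sub, ← hac.integral_deriv_eq_sub, ← L.intervalIntegral_comp_comm hi]
    refine intervalIntegral.integral_congr_ae ?_
    filter_upwards [(hf a b).boundedVariationOn.ae_differentiableAt_of_mem_uIcc] with x hx hxm
    exact ((L.hasFDerivAt.comp_hasDerivAt x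
      (hx (Set.uIoc_subset_uIcc hxm)).hasDerivAt).deriv).symm
  exact Complex.ext (key Complex.reCLM fun z => Complex.abs_re_le_norm z)
    (key Complex.imCLM fun z => Complex.abs_im_le_norm z)

/-! ### Plancherel, translates and total variation -/

open scoped FourierTransform ContDiff

theorem fourierHat_eq_fourier (g : ℝ → ℂ) :
    fourierHat g = fun s => 𝓕 g (s / (2 * Real.pi)) := by
  funext s
  rw [fourierHat, Real.fourier_real_eq]
  refine integral_congr_ae (ae_of_all _ fun t => ?_)
  simp only [Circle.smul_def, Real.fourierChar_apply, smul_eq_mul]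
  congr 2
  push_cast
  have : (Real.pi : ℂ) ≠ 0 := by exact_mod_cast Real.pi_ne_zero
  field_simp

theorem continuous_fourier_of_integrable {f : ℝ → ℂ} (hf : Integrable f) : Continuous (𝓕 f) :=
  VectorFourier.fourierIntegral_continuous Real.continuous_fourierChar
    (by exact continuous_inner) hf

/-- The `L²` Fourier transform is given by the Fourier integral on `L¹ ∩ L²`. -/
theorem coeFn_fourier_toLp_ae_eq {f : ℝ → ℂ} (hf : Integrable f) (hf2 : MemLp f 2) :
    ((𝓕 (hf2.toLp f) : Lp ℂ 2 (volume : Measure ℝ)) : ℝ → ℂ) =ᵐ[volume] 𝓕 f := by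
  refine ae_eq_of_integral_contDiff_smul_eq
    ((Lp.memLp _).locallyIntegrable (by norm_num))
    (continuous_fourier_of_integrable hf).locallyIntegrable fun φ hφ hφc => ?_
  have hφc' : HasCompactSupport fun x => (φ x : ℂ) := hφc.comp_left Complex.ofReal_zero
  let ψ := hφc'.toSchwartzMap (Complex.ofRealCLM.contDiff.comp hφ)
  -- The `L²` transform agrees with the distributional one, so testing on `ψ` moves the transform
  -- onto `ψ`; the multiplication formula moves it back onto `f`.
  have h := congrArg (fun T => T ψ)
    (MeasureTheory.Lp.fourier_toTemperedDistribution_eq (hf2.toLp f))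
  simp only [TemperedDistribution.fourier_apply, Lp.toTemperedDistribution_apply] at h
  have h2 : ∫ ξ, 𝓕 (ψ : ℝ → ℂ) ξ • f ξ = ∫ x, ψ x • 𝓕 f x := by
    simpa using! VectorFourier.integral_fourierIntegral_smul_eq_flip (L := innerₗ ℝ)
      Real.continuous_fourierChar continuous_inner ψ.integrable hf
  have h3 : ∫ x, (𝓕 ψ) x • (hf2.toLp f) x = ∫ ξ, 𝓕 (ψ : ℝ → ℂ) ξ • f ξ := by
    refine integral_congr_ae ?_
    filter_upwards [hf2.coeFn_toLp] with x hx
    rw [hx, SchwartzMap.fourier_coe]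
  rw [h3, h2] at h
  simpa [ψ] using! h.symm

/-- **Plancherel's theorem** for the Fourier integral on `L¹ ∩ L²`. -/
theorem lintegral_enorm_fourier_sq {f : ℝ → ℂ} (hf : Integrable f) (hf2 : MemLp f 2) :
    ∫⁻ ξ, ‖𝓕 f ξ‖ₑ ^ (2 : ℝ) = ∫⁻ x, ‖f x‖ₑ ^ (2 : ℝ) := by
  have h := congrArg ENNReal.ofReal (Lp.norm_fourier_eq (hf2.toLp f))
  simp only [ofReal_norm, Lp.enorm_def] at h
  rw [eLpNorm_congr_ae (coeFn_fourier_toLp_ae_eq hf hf2), eLpNorm_congr_ae hf2.coeFn_toLp,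
    eLpNorm_eq_lintegral_rpow_enorm_toReal (by norm_num) (by norm_num),
    eLpNorm_eq_lintegral_rpow_enorm_toReal (by norm_num) (by norm_num)] at h
  simpa using ENNReal.rpow_left_injective (by norm_num) h

theorem fourier_comp_add_right_sub {g : ℝ → ℂ} (hg : Integrable g) (h ξ : ℝ) :
    𝓕 (fun x => g (x + h) - g x) ξ = (Real.fourierChar (h * ξ) - 1 : ℂ) * 𝓕 g ξ := by
  have h1 : 𝓕 (fun x => g (x + h)) ξ = Real.fourierChar (h * ξ) * 𝓕 g ξ := by
    have := congrFun (VectorFourier.fourierIntegral_comp_add_right Real.fourierChar volume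
      (innerₗ ℝ) g h) ξ
    simp only [innerₗ_apply_apply, Circle.smul_def, smul_eq_mul] at this
    rw [mul_comm h ξ]
    exact this
  have h2 : 𝓕 (fun x => g (x + h) - g x) ξ = 𝓕 (fun x => g (x + h)) ξ - 𝓕 g ξ := by
    simp only [Real.fourier_real_eq, smul_sub]
    have hi {f : ℝ → ℂ} (hf : Integrable f) :
        Integrable fun v => Real.fourierChar (-(v * ξ)) • f v := by
      simpa [mul_comm] using (Real.fourierIntegral_convergent_iff ξ).2 hf
    exact integral_sub (hi (hg.comp_add_right h)) (hi hg)
  rw [h2, h1]; ring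

/-- The angle `2π|t|` lies in `[π/2, π]`, so the character has nonpositive real part. -/
theorem one_le_norm_fourierChar_sub_one {t : ℝ} (h1 : 1 / 4 ≤ |t|) (h2 : |t| ≤ 1 / 2) :
    1 ≤ ‖(Real.fourierChar t - 1 : ℂ)‖ := by
  have hre : (Real.fourierChar t : ℂ).re ≤ 0 := by
    rw [Real.fourierChar_apply, Complex.exp_ofReal_mul_I_re, ← Real.cos_abs, abs_mul,
      abs_of_pos Real.two_pi_pos]
    exact Real.cos_nonpos_of_pi_div_two_le_of_le (by nlinarith [Real.pi_pos])
      (by nlinarith [Real.pi_pos])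
  calc (1 : ℝ) ≤ |(Real.fourierChar t - 1 : ℂ).re| := by
        rw [le_abs]; right; simp; linarith
    _ ≤ _ := Complex.abs_re_le_norm _

/-- A function whose derivative is integrable has bounded variation on the line. -/
theorem boundedVariationOn_univ_of_integrable_deriv {F F' : ℝ → ℂ}
    (hF : ∀ x, HasDerivAt F (F' x) x) (hF' : Integrable F') :
    BoundedVariationOn F Set.univ := by
  have hstep {a b : ℝ} (hab : a ≤ b) : edist (F b) (F a) ≤ ∫⁻ x in Set.Ioc a b, ‖F' x‖ₑ := by
    rw [edist_eq_enorm_sub, ← intervalIntegral.integral_eq_sub_of_hasDerivAt (fun x _ => hF x)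
      hF'.intervalIntegrable, intervalIntegral.integral_of_le hab]
    exact enorm_integral_le_lintegral_enorm _
  refine ne_top_of_le_ne_top hF'.2.ne (iSup_le fun p => ?_)
  obtain ⟨n, u, hu, -⟩ := p
  calc ∑ i ∈ Finset.range n, edist (F (u (i + 1))) (F (u i))
      ≤ ∑ i ∈ Finset.range n, ∫⁻ x in Set.Ioc (u i) (u (i + 1)), ‖F' x‖ₑ :=
        Finset.sum_le_sum fun i _ => hstep (hu i.le_succ)
    _ = ∫⁻ x in ⋃ i ∈ Finset.range n, Set.Ioc (u i) (u (i + 1)), ‖F' x‖ₑ := by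
        refine (lintegral_biUnion_finset ?_ (fun _ _ => measurableSet_Ioc) _).symm
        exact fun i _ j _ hij => hu.pairwise_disjoint_on_Ioc_succ hij
    _ ≤ ∫⁻ x, ‖F' x‖ₑ := setLIntegral_le_lintegral _ _

/-! ### Modulus of continuity and dyadic summation -/

/-- The `L²` modulus of continuity of an absolutely continuous function whose derivative is
in `L^q`, `1 < q ≤ 2`, is of order greater than `1 / 2`. -/
theorem AbsContOnLine.lintegral_enorm_sub_sq_le {g : ℝ → ℂ} (hac : AbsContOnLine g)
    (hloc : LocallyIntegrable (deriv g) volume) {q : ℝ} (hq : 1 < q) (hq2 : q ≤ 2)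
    {h : ℝ} (hh : 0 < h) :
    ∫⁻ x, ‖g (x + h) - g x‖ₑ ^ (2 : ℝ) ≤
      ENNReal.ofReal h ^ (3 - 2 / q) * (∫⁻ x, ‖deriv g x‖ₑ ^ q) ^ (2 / q) := by
  set M := ∫⁻ x, ‖deriv g x‖ₑ ^ q with hM
  have hq0 : 0 < q := by linarith
  have h2q : 1 ≤ 2 / q := by rw [le_div_iff₀ hq0]; linarith
  have hmeas : Measurable fun x => ‖deriv g x‖ₑ := (measurable_deriv g).enorm
  have hh0 : ENNReal.ofReal h ≠ 0 := by simpa using hh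
  let A : ℝ → ℝ≥0∞ := fun x => ∫⁻ t in Set.Ioc 0 h, ‖deriv g (x + t)‖ₑ ^ q
  have hAM (x : ℝ) : A x ≤ M := by
    refine (setLIntegral_le_lintegral _ _).trans_eq ?_
    exact lintegral_add_left_eq_self (fun t => ‖deriv g t‖ₑ ^ q) x
  have hA : ∫⁻ x, A x = M * ENNReal.ofReal h := by
    rw [lintegral_lintegral_swap]
    · simp_rw [lintegral_add_right_eq_self (fun t => ‖deriv g t‖ₑ ^ q), ← hM]
      simp
    · exact ((hmeas.comp (measurable_fst.add measurable_snd)).pow_const q).aemeasurable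
  have hpt (x : ℝ) : ‖g (x + h) - g x‖ₑ ≤ A x ^ (1 / q) * ENNReal.ofReal h ^ (1 - 1 / q) := by
    have hH := ENNReal.lintegral_mul_le_Lp_mul_Lq (volume.restrict (Set.Ioc 0 h))
      (Real.HolderConjugate.conjExponent hq)
      (f := fun t => ‖deriv g (x + t)‖ₑ) (g := fun _ => 1)
      (hmeas.comp (measurable_const_add x)).aemeasurable aemeasurable_const
    have he : 1 / q.conjExponent = 1 - 1 / q := by
      rw [Real.conjExponent, one_div_div, sub_div, div_self hq0.ne']
    simp only [Pi.mul_apply, mul_one, ENNReal.one_rpow, lintegral_const, one_mul,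
      Measure.restrict_apply MeasurableSet.univ, Set.univ_inter, Real.volume_Ioc, sub_zero,
      he] at hH
    refine le_trans ?_ hH
    rw [← hac.integral_deriv_eq_sub hloc, show ∫ t in x..x + h, deriv g t
      = ∫ t in (0 : ℝ)..h, deriv g (x + t) by simp, intervalIntegral.integral_of_le hh.le]
    exact enorm_integral_le_lintegral_enorm _
  -- Since `2 / q ≥ 1`, `A ^ (2 / q)` splits as `A ^ (2 / q - 1) * A`: the first factor is bounded
  -- by a power of `M`, and integrating the second gains one more power of `h`.
  have hpt2 (x : ℝ) : ‖g (x + h) - g x‖ₑ ^ (2 : ℝ) ≤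
      ENNReal.ofReal h ^ (2 - 2 / q) * M ^ (2 / q - 1) * A x := by
    calc ‖g (x + h) - g x‖ₑ ^ (2 : ℝ)
        ≤ (A x ^ (1 / q) * ENNReal.ofReal h ^ (1 - 1 / q)) ^ (2 : ℝ) := by gcongr; exact hpt x
      _ = ENNReal.ofReal h ^ (2 - 2 / q) * (A x ^ (2 / q - 1) * A x) := by
          rw [ENNReal.mul_rpow_of_nonneg _ _ (by norm_num), ← ENNReal.rpow_mul,
            ← ENNReal.rpow_mul, mul_comm]
          nth_rw 3 [← ENNReal.rpow_one (A x)]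
          rw [← ENNReal.rpow_add_of_nonneg _ _ (by linarith) (by norm_num)]
          ring_nf
      _ ≤ ENNReal.ofReal h ^ (2 - 2 / q) * (M ^ (2 / q - 1) * A x) := by
          gcongr
          exact hAM x
      _ = _ := by ring
  have hAmeas : Measurable A :=
    Measurable.lintegral_prod_right' (f := fun z : ℝ × ℝ => ‖deriv g (z.1 + z.2)‖ₑ ^ q)
      ((hmeas.comp (measurable_fst.add measurable_snd)).pow_const q)
  calc ∫⁻ x, ‖g (x + h) - g x‖ₑ ^ (2 : ℝ)
      ≤ ∫⁻ x, ENNReal.ofReal h ^ (2 - 2 / q) * M ^ (2 / q - 1) * A x := lintegral_mono hpt2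
    _ = (ENNReal.ofReal h ^ (2 - 2 / q) * ENNReal.ofReal h ^ (1 : ℝ)) *
          (M ^ (2 / q - 1) * M ^ (1 : ℝ)) := by
        rw [lintegral_const_mul _ hAmeas, hA, ENNReal.rpow_one, ENNReal.rpow_one]; ring
    _ = _ := by
        rw [← ENNReal.rpow_add _ _ hh0 ENNReal.ofReal_ne_top,
          ← ENNReal.rpow_add_of_nonneg _ _ (by linarith) (by norm_num)]
        ring_nf

/-- **Bernstein's criterion**: a continuous function with suitable `L²` bounds on dyadic blocks
is integrable. -/
theorem integrable_of_dyadic_lintegral_sq_le {F : ℝ → ℂ} (hF : Continuous F) {C : ℝ≥0∞}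
    (hC : C ≠ ⊤) {a : ℝ} (ha : 1 < a)
    (hb : ∀ k : ℕ, ∫⁻ x in {x : ℝ | 2 ^ k ≤ |x| ∧ |x| ≤ 2 ^ (k + 1)}, ‖F x‖ₑ ^ (2 : ℝ) ≤
      C * ENNReal.ofReal (((2 : ℝ) ^ k)⁻¹ ^ a)) :
    Integrable F := by
  let B : ℕ → Set ℝ := fun k => {x : ℝ | 2 ^ k ≤ |x| ∧ |x| ≤ 2 ^ (k + 1)}
  -- Cauchy-Schwarz on a block of length about `2 ^ k` gives `(2 ^ (-k * a) * 2 ^ k) ^ (1 / 2) = r ^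
  -- k`.
  let r : ℝ := 2 ^ ((1 - a) / 2)
  have hr0 : 0 < r := by positivity
  have hr1 : r < 1 := Real.rpow_lt_one_of_one_lt_of_neg one_lt_two (by linarith)
  have hvol (k : ℕ) : volume (B k) ≤ ENNReal.ofReal (4 * 2 ^ k) := by
    refine (measure_mono (t := Set.Icc (-2 ^ (k + 1)) (2 ^ (k + 1))) fun x hx => ?_).trans ?_
    · exact abs_le.1 hx.2
    · rw [Real.volume_Icc]
      exact ENNReal.ofReal_le_ofReal (by rw [pow_succ]; linarith)
  have hblock (k : ℕ) : ∫⁻ x in B k, ‖F x‖ₑ ≤ (C * 4) ^ (1 / 2 : ℝ) * ENNReal.ofReal r ^ k := by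
    have hH := ENNReal.lintegral_mul_le_Lp_mul_Lq (volume.restrict (B k))
      Real.HolderConjugate.two_two (f := fun x => ‖F x‖ₑ) (g := fun _ => 1)
      hF.measurable.enorm.aemeasurable aemeasurable_const
    simp only [Pi.mul_apply, mul_one, ENNReal.one_rpow, lintegral_const, one_mul,
      Measure.restrict_apply MeasurableSet.univ, Set.univ_inter] at hH
    refine hH.trans ?_
    calc _ ≤ (C * ENNReal.ofReal (((2 : ℝ) ^ k)⁻¹ ^ a)) ^ (1 / 2 : ℝ) *
          (ENNReal.ofReal (4 * 2 ^ k)) ^ (1 / 2 : ℝ) := by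
          gcongr
          · exact hb k
          · exact hvol k
      _ = (C * 4 * ENNReal.ofReal ((r ^ k) ^ (2 : ℝ))) ^ (1 / 2 : ℝ) := by
          rw [← ENNReal.mul_rpow_of_nonneg _ _ (by norm_num), mul_assoc, mul_assoc,
            ← ENNReal.ofReal_mul (by positivity), ← ENNReal.ofReal_ofNat 4,
            ← ENNReal.ofReal_mul (by norm_num)]
          congr 3
          have h2 : (0 : ℝ) < 2 := two_pos
          rw [← Real.rpow_natCast, ← Real.rpow_natCast, ← Real.rpow_neg h2.le,
            ← Real.rpow_mul h2.le, ← Real.rpow_mul h2.le, ← Real.rpow_mul h2.le, mul_left_comm,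
            ← Real.rpow_add h2]
          congr 2
          ring
      _ = _ := by
          rw [ENNReal.mul_rpow_of_nonneg _ _ (by norm_num),
            ENNReal.ofReal_rpow_of_nonneg (by positivity) (by norm_num),
            ← Real.rpow_mul (by positivity)]
          norm_num [ENNReal.ofReal_pow hr0.le]
  have hcover : (Set.univ : Set ℝ) ⊆ Set.Icc (-1) 1 ∪ ⋃ k, B k := by
    intro x _
    by_cases hx : |x| ≤ 1
    · exact Or.inl (abs_le.1 hx)
    · obtain ⟨n, h1, h2⟩ := exists_nat_pow_near (not_le.1 hx).le one_lt_two
      exact Or.inr (Set.mem_iUnion.2 ⟨n, h1, h2.le⟩)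
  refine ⟨hF.aestronglyMeasurable, ?_⟩
  calc ∫⁻ x, ‖F x‖ₑ = ∫⁻ x in Set.univ, ‖F x‖ₑ := by simp
    _ ≤ ∫⁻ x in Set.Icc (-1) 1 ∪ ⋃ k, B k, ‖F x‖ₑ := lintegral_mono_set hcover
    _ ≤ (∫⁻ x in Set.Icc (-1) 1, ‖F x‖ₑ) + ∫⁻ x in ⋃ k, B k, ‖F x‖ₑ := lintegral_union_le _ _ _
    _ ≤ (∫⁻ x in Set.Icc (-1) 1, ‖F x‖ₑ) +
          ∑' k, (C * 4) ^ (1 / 2 : ℝ) * ENNReal.ofReal r ^ k := by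
        gcongr
        exact (lintegral_iUnion_le _ _).trans (ENNReal.tsum_le_tsum hblock)
    _ < ⊤ := by
        refine ENNReal.add_lt_top.2 ⟨hF.continuousOn.integrableOn_Icc.2, ?_⟩
        rw [ENNReal.tsum_mul_left, ENNReal.tsum_geometric]
        refine ENNReal.mul_lt_top (ENNReal.rpow_lt_top_of_nonneg (by norm_num)
          (ENNReal.mul_ne_top hC (by norm_num))) (ENNReal.inv_lt_top.2 ?_)
        exact tsub_pos_of_lt (ENNReal.ofReal_lt_one.2 hr1)

theorem AbsContOnLine.integrable_fourier {g : ℝ → ℂ} (hac : AbsContOnLine g) (hg : Integrable g)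
    {p : ℝ≥0∞} (hp : 1 < p) (hp2 : p ≤ 2) (hd : MemLp (deriv g) p) : Integrable (𝓕 g) := by
  have hpt : p ≠ ⊤ := ne_top_of_le_ne_top (by norm_num) hp2
  have hp0 : p ≠ 0 := (zero_lt_one.trans hp).ne'
  have hq : 1 < p.toReal := by
    simpa using (ENNReal.toReal_lt_toReal ENNReal.one_ne_top hpt).2 hp
  have hq2 : p.toReal ≤ 2 := by
    simpa using (ENNReal.toReal_le_toReal hpt ENNReal.ofNat_ne_top).2 hp2
  have hloc := hd.locallyIntegrable hp.le
  have hM := lintegral_rpow_enorm_lt_top_of_eLpNorm_lt_top hp0 hpt hd.2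
  have ha : 1 < 3 - 2 / p.toReal := by
    have : 2 / p.toReal < 2 := by rw [div_lt_iff₀ (by linarith)]; linarith
    linarith
  have hCt := ENNReal.rpow_ne_top_of_nonneg (y := 2 / p.toReal) (by positivity) hM.ne
  refine integrable_of_dyadic_lintegral_sq_le (continuous_fourier_of_integrable hg) hCt ha
    fun k => ?_
  have h2k : (0 : ℝ) < 2 ^ k := by positivity
  -- Chosen so that `1/4 ≤ |h * ξ| ≤ 1/2` on the `k`-th block.
  let h : ℝ := (2 ^ k)⁻¹ / 4
  have hh : 0 < h := by positivity
  have hle := hac.lintegral_enorm_sub_sq_le hloc hq hq2 hh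
  have hint : Integrable fun x => g (x + h) - g x := (hg.comp_add_right h).sub hg
  have hmem : MemLp (fun x => g (x + h) - g x) 2 := by
    refine ⟨hint.1, ?_⟩
    rw [eLpNorm_lt_top_iff_lintegral_rpow_enorm_lt_top (by norm_num) (by norm_num)]
    refine lt_of_le_of_lt (by simpa using hle) (ENNReal.mul_lt_top ?_ hCt.lt_top)
    exact ENNReal.rpow_lt_top_of_nonneg (by linarith) ENNReal.ofReal_ne_top
  rw [← lintegral_enorm_fourier_sq hint hmem] at hle
  calc _ ≤ ∫⁻ ξ in {x : ℝ | 2 ^ k ≤ |x| ∧ |x| ≤ 2 ^ (k + 1)},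
        ‖𝓕 (fun x => g (x + h) - g x) ξ‖ₑ ^ (2 : ℝ) := by
        refine setLIntegral_mono' ?_ fun ξ hξ => ?_
        · exact (measurableSet_le measurable_const continuous_abs.measurable).inter
            (measurableSet_le continuous_abs.measurable measurable_const)
        · gcongr
          rw [fourier_comp_add_right_sub hg, enorm_mul]
          refine le_mul_of_one_le_left' ?_
          have habs : |h * ξ| = |ξ| / 2 ^ k / 4 := by
            rw [abs_mul, abs_of_pos hh]; simp only [h]; ring
          have := one_le_norm_fourierChar_sub_one (t := h * ξ)
            (by
              have : 1 ≤ |ξ| / 2 ^ k := (one_le_div h2k).2 hξ.1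
              rw [habs]; linarith)
            (by
              have : |ξ| / 2 ^ k ≤ 2 := by
                rw [div_le_iff₀ h2k, ← pow_succ']; exact hξ.2
              rw [habs]; linarith)
          rw [← ofReal_norm]
          exact ENNReal.one_le_ofReal.2 this
    _ ≤ _ := setLIntegral_le_lintegral _ _
    _ ≤ _ := hle
    _ ≤ _ := by
        rw [mul_comm, ENNReal.ofReal_rpow_of_nonneg hh.le (by linarith)]
        gcongr
        simp only [h]; linarith [inv_pos.2 h2k]

/-! ### Return to `fourierHat` and the four assertions -/

theorem integrable_fourierHat {g : ℝ → ℂ} (h : Integrable (𝓕 g)) : Integrable (fourierHat g) := by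
  rw [fourierHat_eq_fourier]
  exact h.comp_div Real.two_pi_pos.ne'

theorem boundedVariationOn_fourierHat {g h : ℝ → ℂ} (hgh : ∀ x : ℝ, h x = x * g x)
    (hg : Integrable g) (hh : Integrable h) (hF : Integrable (𝓕 h)) :
    BoundedVariationOn (fourierHat g) Set.univ := by
  have hsmul : (fun x : ℝ => x • g x) = h := by
    funext x; rw [hgh, Complex.real_smul]
  have hderiv (ξ : ℝ) : HasDerivAt (𝓕 g) (-2 * Real.pi * Complex.I * 𝓕 h ξ) ξ := by
    convert! Real.hasDerivAt_fourier hg (hsmul ▸ hh) ξ using 1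
    rw [Real.fourier_real_eq, Real.fourier_real_eq, ← integral_const_mul]
    refine integral_congr_ae (ae_of_all _ fun t => ?_)
    simp only [Circle.smul_def, smul_eq_mul, hgh]
    ring
  have hbv := boundedVariationOn_univ_of_integrable_deriv hderiv (hF.const_mul _)
  rw [fourierHat_eq_fourier]
  refine ne_top_of_le_ne_top hbv (eVariationOn.comp_le_of_monotoneOn (𝓕 g)
    (fun s : ℝ => s / (2 * Real.pi)) ?_ (Set.mapsTo_univ _ _))
  exact fun a _ b _ hab => div_le_div_of_nonneg_right hab Real.two_pi_pos.le

/-- An integrable derivative which is of bounded variation is square-integrable. -/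
theorem DerivIsBV.memLp_two {f : ℝ → ℂ} (hf : DerivIsBV f) (hi : Integrable (deriv f)) :
    MemLp (deriv f) 2 := by
  obtain ⟨v, hv, hfv⟩ := hf
  rw [memLp_two_iff_integrable_sq_norm hi.1]
  simp_rw [sq]
  -- Bounded variation bounds `v` by `‖v 0‖` plus its total variation, so the square is a bounded
  -- function times an integrable one.
  refine hi.norm.bdd_mul (c := ‖v 0‖ + (eVariationOn v Set.univ).toReal) hi.norm.1 ?_
  filter_upwards [hfv] with x hx
  have := hv.dist_le (Set.mem_univ x) (Set.mem_univ 0)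
  rw [dist_eq_norm] at this
  rw [norm_norm, hx]
  linarith [norm_le_norm_add_norm_sub' (v x) (v 0)]

theorem proposition9 (g : ℝ → ℂ) :
    -- (a)
    (∀ p : ℝ≥0∞, 1 < p → p ≤ 2 →
      Integrable g volume → AbsContOnLine g → Tendsto g (cocompact ℝ) (𝓝 0) →
      MemLp (deriv g) p volume →
      Integrable (fourierHat g) volume) ∧
    -- (b)
    (∀ h : ℝ → ℂ, (∀ x : ℝ, h x = (x : ℂ) * g x) → ∀ p : ℝ≥0∞, 1 < p → p ≤ 2 →
      Integrable g volume → Integrable h volume → AbsContOnLine h →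
      Tendsto h (cocompact ℝ) (𝓝 0) → MemLp (deriv h) p volume →
      BoundedVariationOn (fourierHat g) Set.univ) ∧
    -- (c)
    (Integrable g volume → AbsContOnLine g → Integrable (deriv g) volume → DerivIsBV g →
      Integrable (fourierHat g) volume) ∧
    -- (d)
    (∀ h : ℝ → ℂ, (∀ x : ℝ, h x = (x : ℂ) * g x) →
      Integrable g volume → Integrable h volume → AbsContOnLine h →
      Integrable (deriv h) volume → DerivIsBV h →
      BoundedVariationOn (fourierHat g) Set.univ) := by
  refine ⟨fun p hp hp2 hg hac _ hd => ?_, fun h hgh p hp hp2 hg hh hac _ hd => ?_,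
    fun hg hac hd hbv => ?_, fun h hgh hg hh hac hd hbv => ?_⟩
  · exact integrable_fourierHat (hac.integrable_fourier hg hp hp2 hd)
  · exact boundedVariationOn_fourierHat hgh hg hh (hac.integrable_fourier hh hp hp2 hd)
  · exact integrable_fourierHat
      (hac.integrable_fourier hg ENNReal.one_lt_two le_rfl (hbv.memLp_two hd))
  · exact boundedVariationOn_fourierHat hgh hg hh
      (hac.integrable_fourier hh ENNReal.one_lt_two le_rfl (hbv.memLp_two hd))
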